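/- Let $n\ge 1$ and let $B_n$ be the group of all bijections $\sigma$ of $[\pm n]=\{-n,\dots,-1,1,\dots,n\}$ with $\sigma(-a)=-\sigma(a)$ for all $a$; write $\sigma=[\sigma(1),\dots,\sigma(n)]$. Let $D_n\le B_n$ be the Weyl group of type $D$, that is, the subgroup of those $\sigma$ for which the number of $i\in\{1,\dots,n\}$ with $\sigma(i)<0$ is even. Let $\ell_D$ be the length function on $D_n$ with respect to its Coxeter generators $s_i=[1,\dots,i-1,i+1,i,i+2,\dots,n]$ for $1\le i<n$ and, if $n\ge 2$, $s_0^D=[-2,-1,3,\dots,n]$: $\ell_D(\sigma)$ is the least $r$ such that $\sigma$ is a product of $r$ generators. For a sequence $a=(a_1,\dots,a_n)$ of integers put $$\mathrm{fmaj}(a)=2\sum_{1\le i<n,\ a_i>a_{i+1}} i\;+\;\bigl|\{i : a_i<0\}\bigr|,$$ and for $\sigma\in D_n$ define the Biagioli–Caselli flag major index $$\mathrm{fmaj}_D(\sigma)=\mathrm{fmaj}\bigl(\sigma(1),\dots,\sigma(n-1),|\sigma(n)|\bigr).$$ Then $\mathrm{fmaj}_D$ and $\ell_D$ are equi-distributed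 on $D_n$: as polynomials in $q$ with integer coefficients, $$\sum_{\sigma\in D_n} q^{\mathrm{fmaj}_D(\sigma)}=\sum_{\sigma\in D_n} q^{\ell_D(\sigma)}.$$ -/

import Mathlib

open Finset Polynomial

/-! ### The set `[±n]` -/

/-- The set `[±n] = {-n, …, -1, 1, …, n}`. -/
abbrev PMInt (n : ℕ) : Type := {a : ℤ // a ≠ 0 ∧ -(n : ℤ) ≤ a ∧ a ≤ n}

namespace PMInt

variable {n : ℕ}

noncomputable instance : Fintype (PMInt n) :=
  Fintype.subtype ((Finset.Icc (-(n : ℤ)) (n : ℤ)).erase 0)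
    fun a => by rw [Finset.mem_erase, Finset.mem_Icc]

theorem neg_mem (a : PMInt n) : -(a : ℤ) ≠ 0 ∧ -(n : ℤ) ≤ -(a : ℤ) ∧ -(a : ℤ) ≤ n := by
  have h := a.2
  omega

/-- `a ↦ -a` on `[±n]`. -/
instance : InvolutiveNeg (PMInt n) where
  neg a := ⟨-(a : ℤ), neg_mem a⟩
  neg_neg a := Subtype.ext (neg_neg (a : ℤ))

@[simp] theorem coe_neg (a : PMInt n) : ((-a : PMInt n) : ℤ) = -(a : ℤ) := rfl

/-- The positive element `k` of `[±n]`, for `1 ≤ k ≤ n`. -/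
def pos (k : ℕ) (h1 : 1 ≤ k) (h2 : k ≤ n) : PMInt n :=
  ⟨(k : ℤ), by omega⟩

/-- The index set `[n]` is modelled by `Fin n`; the element `i : Fin n` stands for `i + 1`. -/
def ofFin (i : Fin n) : PMInt n := pos (i.1 + 1) (by omega) (by omega)

@[simp] theorem coe_pos (k : ℕ) (h1 : 1 ≤ k) (h2 : k ≤ n) :
    ((pos k h1 h2 : PMInt n) : ℤ) = k := rfl

@[simp] theorem coe_ofFin (i : Fin n) : (ofFin i : ℤ) = (i.1 : ℤ) + 1 := by
  simp [ofFin]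

theorem ne_neg (a : PMInt n) : a ≠ -a := by
  intro h
  have h1 := congrArg (fun x : PMInt n => (x : ℤ)) h
  have h2 := a.2
  simp only [coe_neg] at h1
  omega

theorem exists_ofFin (a : PMInt n) :
    ∃ j : Fin n, (0 < (a : ℤ) ∧ a = ofFin j) ∨ ((a : ℤ) < 0 ∧ a = -ofFin j) := by
  have h := a.2
  refine ⟨⟨(a : ℤ).natAbs - 1, by omega⟩, ?_⟩
  rcases lt_or_gt_of_ne h.1 with h0 | h0
  · exact Or.inr ⟨h0, Subtype.ext (by simp only [coe_neg, coe_ofFin]; omega)⟩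
  · exact Or.inl ⟨h0, Subtype.ext (by simp only [coe_ofFin]; omega)⟩

end PMInt

/-! ### Statistics on integer sequences

A sequence `(a_1, …, a_n)` is a function `a : Fin n → ℤ`, with `a_{i+1} = a i`. -/

/-- The major index: the sum of all `i ∈ [n-1]` with `a_i > a_{i+1}`. -/
def majSeq {n : ℕ} (a : Fin n → ℤ) : ℕ :=
  ∑ i : Fin n, if h : i.1 + 1 < n then (if a i > a ⟨i.1 + 1, h⟩ then i.1 + 1 else 0) else 0

/-- The number of negative entries. -/
def negSeq {n : ℕ} (a : Fin n → ℤ) : ℕ := #{i : Fin n | a i < 0}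

/-- The flag major index `2 · maj + neg` of a sequence. -/
def fmajSeq {n : ℕ} (a : Fin n → ℤ) : ℕ := 2 * majSeq a + negSeq a

/-! ### The hyperoctahedral group -/

/-- The group `B_n` of bijections `σ` of `[±n]` with `σ(-a) = -σ(a)` for all `a`. -/
def hyperoctahedral (n : ℕ) : Subgroup (Equiv.Perm (PMInt n)) where
  carrier := {σ | ∀ a, σ (-a) = -σ a}
  mul_mem' {σ τ} hσ hτ a := by
    rw [Equiv.Perm.mul_apply, Equiv.Perm.mul_apply, hτ a, hσ (τ a)]
  one_mem' _ := rfl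
  inv_mem' {σ} hσ a := by
    apply σ.injective
    rw [hσ (σ⁻¹ a)]
    simp

theorem mem_hyperoctahedral {n : ℕ} {σ : Equiv.Perm (PMInt n)} :
    σ ∈ hyperoctahedral n ↔ ∀ a, σ (-a) = -σ a := Iff.rfl

noncomputable instance (n : ℕ) : DecidablePred (· ∈ hyperoctahedral n) :=
  fun _ => decidable_of_iff _ mem_hyperoctahedral.symm

/-- The window `(σ(1), …, σ(n))` of a signed permutation. -/
def window {n : ℕ} (σ : hyperoctahedral n) : Fin n → ℤ :=
  fun i => ((σ : Equiv.Perm (PMInt n)) (PMInt.ofFin i) : ℤ)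

/-- `neg(σ)`, the number of negative entries of the window. -/
def negCount {n : ℕ} (σ : hyperoctahedral n) : ℕ := negSeq (window σ)

theorem neg_one_pow_negCount {n : ℕ} (σ : hyperoctahedral n) :
    (-1 : ℤ) ^ negCount σ = ∏ i : Fin n, if window σ i < 0 then (-1 : ℤ) else 1 := by
  rw [Finset.prod_ite]
  simp [negCount, negSeq]

theorem neg_one_pow_negCount_mul {n : ℕ} (σ τ : hyperoctahedral n) :
    (-1 : ℤ) ^ negCount (σ * τ) = (-1) ^ negCount σ * (-1) ^ negCount τ := by
  simp only [neg_one_pow_negCount]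
  choose j hj using fun i : Fin n => PMInt.exists_ofFin ((τ : Equiv.Perm (PMInt n)) (PMInt.ofFin i))
  have hinj : Function.Injective j := by
    intro a b hab
    have key : (τ : Equiv.Perm (PMInt n)) (PMInt.ofFin a) = τ.1 (PMInt.ofFin b) ∨
        (τ : Equiv.Perm (PMInt n)) (PMInt.ofFin a) = τ.1 (-PMInt.ofFin b) := by
      rw [τ.2 (PMInt.ofFin b)]
      rcases hj a with ⟨_, ha⟩ | ⟨_, ha⟩ <;> rcases hj b with ⟨_, hb⟩ | ⟨_, hb⟩ <;>
        rw [ha, hb, hab] <;> simp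
    have hext : ((PMInt.ofFin a : PMInt n) : ℤ) = PMInt.ofFin b ∨
        ((PMInt.ofFin a : PMInt n) : ℤ) = ((-PMInt.ofFin b : PMInt n) : ℤ) :=
      key.imp (fun h => congrArg _ (τ.1.injective h)) (fun h => congrArg _ (τ.1.injective h))
    simp only [PMInt.coe_neg, PMInt.coe_ofFin] at hext
    exact Fin.ext (by omega)
  have hbij : Function.Bijective j := Finite.injective_iff_bijective.mp hinj
  rw [← Function.Bijective.prod_comp hbij (fun i => if window σ i < 0 then (-1 : ℤ) else 1),
    ← Finset.prod_mul_distrib]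
  refine Finset.prod_congr rfl fun i _ => ?_
  have hne : ((σ : Equiv.Perm (PMInt n)) (PMInt.ofFin (j i)) : ℤ) ≠ 0 :=
    (σ.1 (PMInt.ofFin (j i))).2.1
  have hτ : window τ i = ((τ : Equiv.Perm (PMInt n)) (PMInt.ofFin i) : ℤ) := rfl
  have hστ : window (σ * τ) i = (σ.1 (τ.1 (PMInt.ofFin i)) : ℤ) := rfl
  have hσ : window σ (j i) = (σ.1 (PMInt.ofFin (j i)) : ℤ) := rfl
  rcases hj i with ⟨h0, h⟩ | ⟨h0, h⟩
  · rw [h] at hστ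
    split_ifs <;> omega
  · rw [h, σ.2, PMInt.coe_neg] at hστ
    split_ifs <;> omega

/-! ### The Weyl group of type `D` -/

/-- The group `D_n` of signed permutations with an even number of negative entries. -/
def weylD (n : ℕ) : Subgroup (hyperoctahedral n) where
  carrier := {σ | Even (negCount σ)}
  mul_mem' {σ τ} hσ hτ := by
    simp only [Set.mem_ofPred_eq, ← neg_one_pow_eq_one_iff_even (R := ℤ) (by decide)] at hσ hτ ⊢
    rw [neg_one_pow_negCount_mul, hσ, hτ, mul_one]
  one_mem' := by
    have h : negCount (1 : hyperoctahedral n) = 0 := by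
      rw [negCount, negSeq, Finset.card_eq_zero]
      refine Finset.filter_eq_empty_iff.mpr ?_
      intro i _
      have hi : window (1 : hyperoctahedral n) i = (i.1 : ℤ) + 1 := by
        simp [window]
      omega
    simp [h]
  inv_mem' {σ} hσ := by
    have h := neg_one_pow_negCount_mul σ⁻¹ (σ * σ)
    have h2 := neg_one_pow_negCount_mul σ σ
    simp only [Set.mem_ofPred_eq, ← neg_one_pow_eq_one_iff_even (R := ℤ) (by decide)] at hσ ⊢
    rw [inv_mul_cancel_left, h2, hσ, mul_one, mul_one] at h
    exact h.symm

theorem mem_weylD {n : ℕ} {σ : hyperoctahedral n} : σ ∈ weylD n ↔ Even (negCount σ) := Iff.rfl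

noncomputable instance (n : ℕ) : DecidablePred (· ∈ weylD n) :=
  fun _ => decidable_of_iff _ mem_weylD.symm

/-- For `a ≠ ±b`, the bijection of `[±n]` that exchanges `a` with `b` and `-a` with `-b`. -/
def signedSwapPerm {n : ℕ} (a b : PMInt n) : Equiv.Perm (PMInt n) :=
  Equiv.swap a b * Equiv.swap (-a) (-b)

theorem signedSwapPerm_mem {n : ℕ} (a b : PMInt n) : signedSwapPerm a b ∈ hyperoctahedral n := by
  intro c
  have ha := PMInt.ne_neg a
  have hb := PMInt.ne_neg b
  simp only [signedSwapPerm, Equiv.Perm.mul_apply, Equiv.swap_apply_def]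
  split_ifs <;> simp only [Subtype.ext_iff, PMInt.coe_neg] at * <;> omega

/-- `signedSwapPerm a b` as an element of `B_n`. -/
def signedSwap {n : ℕ} (a b : PMInt n) : hyperoctahedral n :=
  ⟨signedSwapPerm a b, signedSwapPerm_mem a b⟩

/-- The signed permutation `s_i = [1, …, i-1, i+1, i, i+2, …, n]`, for `1 ≤ i < n`. -/
def simpleS {n : ℕ} (i : ℕ) (h1 : 1 ≤ i) (h2 : i < n) : hyperoctahedral n :=
  signedSwap (PMInt.pos i h1 h2.le) (PMInt.pos (i + 1) (by omega) h2)

/-- The signed permutation `s_0^D = [-2, -1, 3, …, n]`, for `2 ≤ n`. -/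
def simpleS0D {n : ℕ} (h : 2 ≤ n) : hyperoctahedral n :=
  signedSwap (PMInt.pos 1 le_rfl (by omega)) (-PMInt.pos 2 (by omega) h)

/-- The set of Coxeter generators of `D_n`: all `s_i` with `1 ≤ i < n`, together with `s_0^D` if
`n ≥ 2`. -/
def coxeterGeneratorsD (n : ℕ) : Set (weylD n) :=
  {g | (∃ (i : ℕ) (h1 : 1 ≤ i) (h2 : i < n), (g : hyperoctahedral n) = simpleS i h1 h2) ∨
    ∃ h : 2 ≤ n, (g : hyperoctahedral n) = simpleS0D h}

/-- The length of `g` with respect to `S`: the least `r` such that `g` is a product of `r`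
elements of `S`. -/
noncomputable def wordLength {G : Type*} [Group G] (S : Set G) (g : G) : ℕ :=
  sInf {r | ∃ w : List G, w.length = r ∧ (∀ s ∈ w, s ∈ S) ∧ w.prod = g}

/-- The Coxeter length `ℓ_D` on `D_n`. -/
noncomputable def lengthD {n : ℕ} (σ : weylD n) : ℕ := wordLength (coxeterGeneratorsD n) σ

/-- `fmaj_D(σ) = fmaj(σ(1), …, σ(n-1), |σ(n)|)`. -/
def fmajD {n : ℕ} (σ : weylD n) : ℕ :=
  fmajSeq fun i : Fin n => if i.1 + 1 = n then |window σ.1 i| else window σ.1 i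

/-!
Both sides equal `∏ m ∈ range N, [m + 2]_q (1 + q ^ (m + 1))`, where `n = N + 1` and `[k]_q` is
`1 + q + ⋯ + q ^ (k - 1)`. A signed permutation is encoded by its absolute values, a permutation `π`,
and a sign vector `ε` (`signedWord`, `sum_weylD_window`).

The length `ℓ_D` counts the pairs of positions `i < j` with `a i > a j`, and once more those with
`a i + a j < 0` (`lengthD_eq_lenSeq`): a generator changes this count by one, and an element that no
generator lowers is the identity. The weight of a pair does not depend on the sign of its left entry,
so the first sign is irrelevant, and the sum over `D_n` is half of the sum over all signed
permutations (`two_nsmul_sum_filter`). That sum is computed by removing the last entry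
(`sum_pow_lenSeq`).

The statistic `fmaj_D` ignores the sign of the last entry, so the sum over `D_n` may be replaced by
the sum over the signed permutations with positive last entry. Fix the set of values, with `m`
negative ones. Its arrangements correspond to permutations by relative order, and the condition on the
last entry says that it is not among the `m` smallest. By the distribution of `maj` over permutations
with given last entry (`sum_pow_majSeq_permOfLast`) the arrangements contribute
`q ^ m [n - m]_{q²} [n - 1]_{q²}!`. Summing over the sign vectors is a binomial expansion
(`one_sub_sq_mul_sum_signs`), and `[k]_{q²} (1 + q) = [k]_q (1 + q ^ k)` gives the product
(`sum_pow_fmajD`).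
-/

/-! ### The Coxeter length as a weighted number of inversions -/

/-- A function `L` that vanishes at `1`, grows by at most one under right multiplication by a
generator, and for which
every `g ≠ 1` has a generator whose inverse lowers it by one, is the word length. -/
theorem wordLength_eq_of_descent {G : Type*} [Group G] {S : Set G} (L : G → ℕ) (h1 : L 1 = 0)
    (hmul : ∀ g, ∀ s ∈ S, L (g * s) ≤ L g + 1)
    (hdesc : ∀ g, g ≠ 1 → ∃ s ∈ S, L (g * s⁻¹) + 1 = L g) (g : G) :
    wordLength S g = L g := by
  have hle : ∀ w : List G, (∀ s ∈ w, s ∈ S) → L w.prod ≤ w.length := by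
    intro w
    induction w using List.reverseRecOn with
    | nil => simp [h1]
    | append_singleton w s ih =>
      intro hw
      have h := ih fun t ht => hw t (by simp [ht])
      have h' := hmul w.prod s (hw s (by simp))
      simp only [List.prod_append, List.prod_singleton, List.length_append, List.length_singleton]
      omega
  have hex : ∀ (r : ℕ) (g : G), L g = r →
      ∃ w : List G, w.length = r ∧ (∀ s ∈ w, s ∈ S) ∧ w.prod = g := by
    intro r
    induction r with
    | zero =>
      intro g hg
      refine ⟨[], rfl, by simp, ?_⟩
      by_contra hne
      obtain ⟨s, -, hs⟩ := hdesc g fun h => hne (by simp [h])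
      omega
    | succ r ih =>
      intro g hg
      obtain ⟨s, hsS, hs⟩ := hdesc g (by rintro rfl; omega)
      obtain ⟨w, hw, hwS, hprod⟩ := ih (g * s⁻¹) (by omega)
      refine ⟨w ++ [s], by simp [hw], ?_, by simp [hprod]⟩
      intro t ht
      rcases List.mem_append.mp ht with ht | ht
      · exact hwS t ht
      · rw [List.mem_singleton.mp ht]; exact hsS
  obtain ⟨w, hw⟩ := hex (L g) g rfl
  apply le_antisymm
  · exact Nat.sInf_le ⟨w, hw⟩
  · refine le_csInf ⟨_, w, hw⟩ ?_
    rintro r ⟨v, rfl, hv, rfl⟩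
    exact hle v hv

/-- The contribution of a pair of entries `x`, `y`, with `x` to the left of `y`, to the length of
type `D`: an inversion `x > y` and a negative sum `x + y < 0` count one each. -/
def pairWeight (x y : ℤ) : ℕ := (if y < x then 1 else 0) + (if x + y < 0 then 1 else 0)

/-- The number of pairs of positions `i < j` with `a i > a j`, plus the number of those with
`a i + a j < 0`. On windows of elements of `D_n` this is the Coxeter length. -/
def lenSeq {n : ℕ} (a : Fin n → ℤ) : ℕ :=
  ∑ i : Fin n, ∑ j : Fin n, if i < j then pairWeight (a i) (a j) else 0

theorem pairWeight_neg_left (x y : ℤ) : pairWeight (-x) y = pairWeight x y := by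
  unfold pairWeight
  split_ifs <;> omega

theorem lenSeq_comp_swap {n : ℕ} (a : Fin n → ℤ) (i j : Fin n) (hij : i.1 + 1 = j.1) :
    lenSeq (a ∘ Equiv.swap i j) + pairWeight (a i) (a j) =
      lenSeq a + pairWeight (a j) (a i) := by
  -- reindexing by the swap changes the order of the two positions `i` and `j` only
  have hre : lenSeq (a ∘ Equiv.swap i j) = ∑ k : Fin n, ∑ l : Fin n,
      if Equiv.swap i j k < Equiv.swap i j l then pairWeight (a k) (a l) else 0 := by
    unfold lenSeq
    rw [← Equiv.sum_comp (Equiv.swap i j)]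
    refine sum_congr rfl fun k _ => ?_
    rw [← Equiv.sum_comp (Equiv.swap i j)]
    simp
  have hsingle : ∀ u v : Fin n, pairWeight (a u) (a v) =
      ∑ k : Fin n, ∑ l : Fin n, if k = u ∧ l = v then pairWeight (a k) (a l) else 0 := by
    intro u v
    simp [ite_and]
  rw [hre, hsingle i j, hsingle j i, lenSeq]
  simp only [← sum_add_distrib]
  refine sum_congr rfl fun k _ => sum_congr rfl fun l _ => ?_
  generalize pairWeight (a k) (a l) = c
  simp only [Equiv.swap_apply_def]
  split_ifs <;> simp only [Fin.lt_def, Fin.ext_iff] at * <;> omega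

/-- Changing the signs of the first two entries affects only the weight of that pair: in a pair with
a later position the sign of the left entry is irrelevant. -/
theorem lenSeq_neg_first_two {n : ℕ} (a : Fin n → ℤ) (i j : Fin n) (hi : i.1 = 0) (hj : j.1 = 1) :
    lenSeq (fun k => if k = i ∨ k = j then -a k else a k) + pairWeight (a i) (a j) =
      lenSeq a + pairWeight (-a i) (-a j) := by
  have hsingle : ∀ c : ℕ, c =
      ∑ k : Fin n, ∑ l : Fin n, if k = i ∧ l = j then c else 0 := by
    intro c
    simp [ite_and]
  rw [hsingle (pairWeight (a i) (a j)), hsingle (pairWeight (-a i) (-a j)), lenSeq, lenSeq]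
  simp only [← sum_add_distrib]
  refine sum_congr rfl fun k _ => sum_congr rfl fun l _ => ?_
  by_cases hkl : k < l
  · by_cases h : k = i ∧ l = j
    · obtain ⟨rfl, rfl⟩ := h
      simp [hkl, add_comm]
    · have hl : ¬ (l = i ∨ l = j) := by
        simp only [Fin.lt_def, Fin.ext_iff] at *
        omega
      simp only [hkl, h, hl, if_true, if_false]
      split_ifs <;> simp [pairWeight_neg_left]
  · have h : ¬ (k = i ∧ l = j) := by
      simp only [Fin.lt_def, Fin.ext_iff] at *
      omega
    simp [hkl, h]

theorem window_ne_zero {n : ℕ} (σ : hyperoctahedral n) (i : Fin n) : window σ i ≠ 0 :=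
  (σ.1 (PMInt.ofFin i)).2.1

theorem PMInt.ofFin_injective {n : ℕ} : Function.Injective (PMInt.ofFin (n := n)) := by
  intro i j h
  have h := congrArg (fun x : PMInt n => (x : ℤ)) h
  simp only [PMInt.coe_ofFin] at h
  exact Fin.ext (by omega)

theorem PMInt.ofFin_ne_neg_ofFin {n : ℕ} (i j : Fin n) : PMInt.ofFin i ≠ -PMInt.ofFin j := by
  intro h
  have h := congrArg (fun x : PMInt n => (x : ℤ)) h
  simp only [PMInt.coe_ofFin, PMInt.coe_neg] at h
  omega

theorem window_ne_of_ne {n : ℕ} (σ : hyperoctahedral n) {i j : Fin n} (h : i ≠ j) :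
    window σ i ≠ window σ j := fun h' =>
  h (PMInt.ofFin_injective (σ.1.injective (Subtype.ext h')))

theorem window_ne_neg {n : ℕ} (σ : hyperoctahedral n) (i j : Fin n) :
    window σ i ≠ -window σ j := by
  intro h'
  have h : σ.1 (PMInt.ofFin i) = σ.1 (-PMInt.ofFin j) := by
    rw [σ.2]
    exact Subtype.ext h'
  exact PMInt.ofFin_ne_neg_ofFin i j (σ.1.injective h)

theorem window_injective {n : ℕ} : Function.Injective (window (n := n)) := by
  intro σ τ h
  have h' : ∀ i, σ.1 (PMInt.ofFin i) = τ.1 (PMInt.ofFin i) := fun i => Subtype.ext (congrFun h i)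
  refine Subtype.ext (Equiv.ext fun a => ?_)
  obtain ⟨j, ⟨-, rfl⟩ | ⟨-, rfl⟩⟩ := PMInt.exists_ofFin a
  · exact h' j
  · rw [σ.2, τ.2, h']

theorem window_mul_signedSwap {n : ℕ} (σ : hyperoctahedral n) (i j : Fin n) :
    window (σ * signedSwap (PMInt.ofFin i) (PMInt.ofFin j)) = window σ ∘ Equiv.swap i j := by
  funext k
  have h : signedSwapPerm (PMInt.ofFin i) (PMInt.ofFin j) (PMInt.ofFin k) =
      PMInt.ofFin (Equiv.swap i j k) := by
    rw [signedSwapPerm, Equiv.Perm.mul_apply,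
      Equiv.swap_apply_of_ne_of_ne (PMInt.ofFin_ne_neg_ofFin k i) (PMInt.ofFin_ne_neg_ofFin k j),
      PMInt.ofFin_injective.map_swap]
  exact congrArg (fun x => (σ.1 x : ℤ)) h

theorem window_mul_signedSwap_neg {n : ℕ} (σ : hyperoctahedral n) {i j : Fin n} (hij : i ≠ j) :
    window (σ * signedSwap (PMInt.ofFin i) (-PMInt.ofFin j)) =
      (fun k => if k = i ∨ k = j then -window σ k else window σ k) ∘ Equiv.swap i j := by
  funext k
  have h : signedSwapPerm (PMInt.ofFin i) (-PMInt.ofFin j) (PMInt.ofFin k) =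
      if k = i ∨ k = j then -PMInt.ofFin (Equiv.swap i j k) else PMInt.ofFin k := by
    have h1 := PMInt.ofFin_injective (n := n)
    have h2 := PMInt.ofFin_ne_neg_ofFin (n := n)
    simp only [signedSwapPerm, Equiv.Perm.mul_apply, Equiv.swap_apply_def, neg_neg]
    by_cases hi : k = i
    · subst hi
      simp [h1.eq_iff, h2, hij]
    · by_cases hj : k = j
      · subst hj
        simp [h1.eq_iff, h2, hij, hi, (h2 _ _).symm]
      · simp [h1.eq_iff, h2, hi, hj]
  refine (congrArg (fun x => (σ.1 x : ℤ)) h).trans ?_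
  by_cases hi : k = i
  · subst hi
    simpa [window] using congrArg (fun x : PMInt n => (x : ℤ)) (σ.2 (PMInt.ofFin j))
  · by_cases hj : k = j
    · subst hj
      simpa [window] using congrArg (fun x : PMInt n => (x : ℤ)) (σ.2 (PMInt.ofFin i))
    · simp [hi, hj, window, Equiv.swap_apply_of_ne_of_ne]

theorem simpleS_succ {n k : ℕ} (h : k + 1 < n) :
    simpleS (k + 1) (by omega) h =
      signedSwap (PMInt.ofFin ⟨k, by omega⟩) (PMInt.ofFin ⟨k + 1, h⟩) := rfl

theorem simpleS0D_eq {n : ℕ} (h : 2 ≤ n) :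
    simpleS0D h = signedSwap (PMInt.ofFin ⟨0, by omega⟩) (-PMInt.ofFin ⟨1, h⟩) := rfl

theorem signedSwap_mul_self {n : ℕ} (a b : PMInt n) :
    signedSwap a b * signedSwap a b = 1 := by
  refine Subtype.ext ?_
  change signedSwapPerm a b * signedSwapPerm a b = 1
  rcases eq_or_ne a b with rfl | h1
  · simp only [signedSwapPerm, Equiv.swap_self]
    rfl
  rcases eq_or_ne a (-b) with rfl | h2
  · simp [signedSwapPerm, Equiv.swap_comm]
  have h2' : b ≠ -a := fun h => h2 (by rw [h, neg_neg])
  have hcomm : Equiv.swap a b * Equiv.swap (-a) (-b) = Equiv.swap (-a) (-b) * Equiv.swap a b := by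
    rw [Equiv.mul_swap_eq_swap_mul,
      Equiv.swap_apply_of_ne_of_ne (PMInt.ne_neg a).symm h2'.symm,
      Equiv.swap_apply_of_ne_of_ne h2.symm (PMInt.ne_neg b).symm]
  rw [signedSwapPerm]
  nth_rewrite 2 [hcomm]
  rw [mul_assoc, Equiv.swap_mul_self_mul, Equiv.swap_mul_self]

theorem lenSeq_window_mul_simpleS {n k : ℕ} (σ : hyperoctahedral n) (h : k + 1 < n) :
    lenSeq (window (σ * simpleS (k + 1) (by omega) h)) =
      if window σ ⟨k, by omega⟩ < window σ ⟨k + 1, h⟩ then lenSeq (window σ) + 1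
      else lenSeq (window σ) - 1 := by
  have hs := lenSeq_comp_swap (window σ) ⟨k, by omega⟩ ⟨k + 1, h⟩ rfl
  have hne : window σ ⟨k, by omega⟩ ≠ window σ ⟨k + 1, h⟩ := window_ne_of_ne σ (by simp)
  rw [simpleS_succ, window_mul_signedSwap]
  unfold pairWeight at hs
  split_ifs at hs ⊢ <;> omega

theorem lenSeq_window_mul_simpleS0D {n : ℕ} (σ : hyperoctahedral n) (h : 2 ≤ n) :
    lenSeq (window (σ * simpleS0D h)) =
      if 0 < window σ ⟨0, by omega⟩ + window σ ⟨1, h⟩ then lenSeq (window σ) + 1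
      else lenSeq (window σ) - 1 := by
  have hs := lenSeq_comp_swap (fun k => if k = (⟨0, by omega⟩ : Fin n) ∨ k = ⟨1, h⟩ then
    -window σ k else window σ k) ⟨0, by omega⟩ ⟨1, h⟩ rfl
  have hn := lenSeq_neg_first_two (window σ) ⟨0, by omega⟩ ⟨1, h⟩ rfl rfl
  have hne := window_ne_neg σ ⟨0, by omega⟩ ⟨1, h⟩
  rw [simpleS0D_eq, window_mul_signedSwap_neg _ (by simp)]
  simp only [true_or, or_true, if_true] at hs
  unfold pairWeight at hs hn
  split_ifs at hs hn ⊢ <;> omega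

theorem simpleS_mul_self {n k : ℕ} (h : k + 1 < n) :
    simpleS (n := n) (k + 1) (by omega) h * simpleS (k + 1) (by omega) h = 1 :=
  signedSwap_mul_self _ _

theorem simpleS0D_mul_self {n : ℕ} (h : 2 ≤ n) :
    simpleS0D h * simpleS0D h = 1 :=
  signedSwap_mul_self _ _

theorem simpleS_mem_weylD {n k : ℕ} (h : k + 1 < n) :
    simpleS (n := n) (k + 1) (by omega) h ∈ weylD n := by
  have hz : negSeq (window (1 : hyperoctahedral n)) = 0 := by
    rw [negSeq, Finset.card_eq_zero]
    refine Finset.filter_eq_empty_iff.mpr fun i _ => ?_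
    simp only [window, OneMemClass.coe_one, Equiv.Perm.coe_one, id_eq, PMInt.coe_ofFin]
    omega
  have hw : window (simpleS (n := n) (k + 1) (by omega) h) =
      window (1 : hyperoctahedral n) ∘ Equiv.swap ⟨k, by omega⟩ ⟨k + 1, h⟩ := by
    rw [← window_mul_signedSwap, one_mul, simpleS_succ]
  rw [mem_weylD, negCount, hw]
  rw [negSeq, Finset.card_eq_zero, Finset.filter_eq_empty_iff] at hz
  rw [negSeq, Finset.filter_eq_empty_iff.mpr]
  · simp
  · intro i _
    exact hz (mem_univ _)

theorem simpleS0D_mem_weylD {n : ℕ} (h : 2 ≤ n) : simpleS0D h ∈ weylD n := by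
  have h1 : ∀ k : Fin n, window (1 : hyperoctahedral n) k = k.1 + 1 := by
    simp [window]
  have hw : window (simpleS0D h) =
      (fun k => if k = (⟨0, by omega⟩ : Fin n) ∨ k = ⟨1, h⟩ then -window (1 : hyperoctahedral n) k
        else window (1 : hyperoctahedral n) k) ∘ Equiv.swap ⟨0, by omega⟩ ⟨1, h⟩ := by
    rw [← window_mul_signedSwap_neg _ (by simp), one_mul, simpleS0D_eq]
  have hset : ({i : Fin n | window (simpleS0D h) i < 0} : Finset (Fin n)) =
      {⟨0, by omega⟩, ⟨1, h⟩} := by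
    ext k
    simp only [hw, Function.comp_apply, h1, mem_filter, mem_univ, true_and, mem_insert,
      mem_singleton, Equiv.swap_apply_def]
    split_ifs <;> simp only [Fin.ext_iff] at * <;> first | omega | tauto
  rw [mem_weylD, negCount, negSeq, hset, Finset.card_pair (by simp)]
  exact even_two

theorem natAbs_window_le {n : ℕ} (σ : hyperoctahedral n) (i : Fin n) :
    (window σ i).natAbs ≤ n := by
  have h : -(n : ℤ) ≤ window σ i ∧ window σ i ≤ n := (σ.1 (PMInt.ofFin i)).2.2
  omega

/-- Without descents the entries satisfy `|σ(1)| < σ(2) < ⋯ < σ(n)`, hence `|σ(i)| = i`, and only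
`σ(1)` could be negative, which the parity of the number of signs excludes. -/
theorem eq_one_of_no_descent {n : ℕ} (σ : weylD n)
    (hS : ∀ k (h : k + 1 < n), window σ.1 ⟨k, by omega⟩ < window σ.1 ⟨k + 1, h⟩)
    (h0 : ∀ h : 2 ≤ n, 0 < window σ.1 ⟨0, by omega⟩ + window σ.1 ⟨1, h⟩) : σ = 1 := by
  -- lower bounds from the left, upper bounds from the right
  have habs : ∀ k (h : k < n), k + 1 ≤ (window σ.1 ⟨k, h⟩).natAbs ∧
      (1 ≤ k → 0 < window σ.1 ⟨k, h⟩) := by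
    intro k
    induction k with
    | zero =>
      intro h
      have := window_ne_zero σ.1 ⟨0, h⟩
      omega
    | succ k ih =>
      intro h
      have h1 := ih (by omega)
      have h2 := hS k h
      rcases Nat.eq_zero_or_pos k with rfl | hk
      · have := h0 (by omega)
        have := h1.1
        simp only [zero_add] at h2 this ⊢
        omega
      · have := h1.2 hk
        omega
  have hle : ∀ m k (h : k < n), n = k + m + 1 → (window σ.1 ⟨k, h⟩).natAbs ≤ k + 1 := by
    intro m
    induction m with
    | zero =>
      intro k h hk
      have := natAbs_window_le σ.1 ⟨k, h⟩
      omega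
    | succ m ih =>
      intro k h hk
      have h1 := ih (k + 1) (by omega) (by omega)
      have h2 := hS k (by omega)
      have h3 := habs (k + 1) (by omega)
      rcases Nat.eq_zero_or_pos k with rfl | hk
      · have := h0 (by omega)
        simp only [zero_add] at h1 h2 h3
        omega
      · have := (habs k h).2 hk
        omega
  have heq : ∀ i : Fin n, (window σ.1 i).natAbs = i.1 + 1 := fun i =>
    le_antisymm (hle (n - i.1 - 1) i.1 i.2 (by omega)) (habs i.1 i.2).1
  have hpos : ∀ i : Fin n, 0 < window σ.1 i := by
    by_contra! hneg
    obtain ⟨i, hi⟩ := hneg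
    have hset : ({j : Fin n | window σ.1 j < 0} : Finset (Fin n)) = {i} := by
      ext j
      have hj := (habs j.1 j.2).2
      have hi' := (habs i.1 i.2).2
      have hne := window_ne_zero σ.1 i
      simp only [mem_filter, mem_univ, true_and, mem_singleton, Fin.ext_iff]
      constructor
      · intro h
        by_contra hij
        simp only [Fin.eta] at hj hi'
        omega
      · intro h
        rw [Fin.ext h]
        omega
    have hev := mem_weylD.mp σ.2
    rw [negCount, negSeq, hset, card_singleton] at hev
    exact absurd hev (by decide)
  refine Subtype.ext (window_injective (funext fun i => ?_))
  have h1 : window (1 : hyperoctahedral n) i = i.1 + 1 := by simp [window]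
  have h2 := heq i
  have h3 := hpos i
  change window σ.1 i = window (1 : hyperoctahedral n) i
  omega

theorem lenSeq_window_one (n : ℕ) : lenSeq (window (1 : hyperoctahedral n)) = 0 := by
  have h1 : ∀ k : Fin n, window (1 : hyperoctahedral n) k = k.1 + 1 := by
    simp [window]
  refine sum_eq_zero fun i _ => sum_eq_zero fun j _ => ?_
  simp only [h1, pairWeight, Fin.lt_def]
  split_ifs <;> omega

theorem lenSeq_ne_zero {n : ℕ} (σ : hyperoctahedral n) {i j : Fin n} (hij : i < j)
    (h : pairWeight (window σ i) (window σ j) ≠ 0) : lenSeq (window σ) ≠ 0 := by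
  intro h0
  simp only [lenSeq, sum_eq_zero_iff] at h0
  have := h0 i (mem_univ _) j (mem_univ _)
  simp [hij, h] at this

/-- The combinatorial formula for the Coxeter length of type `D`. -/
theorem lengthD_eq_lenSeq {n : ℕ} (σ : weylD n) : lengthD σ = lenSeq (window σ.1) := by
  refine wordLength_eq_of_descent (fun τ : weylD n => lenSeq (window τ.1))
    (lenSeq_window_one n) ?_ ?_ σ
  · rintro τ s (⟨i, h1, h2, hs⟩ | ⟨h, hs⟩)
    · obtain ⟨k, rfl⟩ : ∃ k, i = k + 1 := ⟨i - 1, by omega⟩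
      have := lenSeq_window_mul_simpleS τ.1 h2
      simp only [Subgroup.coe_mul, hs]
      split_ifs at this <;> omega
    · have := lenSeq_window_mul_simpleS0D τ.1 h
      simp only [Subgroup.coe_mul, hs]
      split_ifs at this <;> omega
  · intro τ hτ
    by_contra! hno
    refine hτ (eq_one_of_no_descent τ ?_ ?_)
    · intro k h
      by_contra hlt
      have hne := hno ⟨simpleS (k + 1) (by omega) h, simpleS_mem_weylD h⟩
        (Or.inl ⟨k + 1, by omega, h, rfl⟩)
      have hinv : (simpleS (n := n) (k + 1) (by omega) h)⁻¹ = simpleS (k + 1) (by omega) h :=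
        inv_eq_of_mul_eq_one_left (simpleS_mul_self h)
      have hpos := lenSeq_ne_zero τ.1 (i := ⟨k, by omega⟩) (j := ⟨k + 1, h⟩) (by simp) (by
        have := window_ne_of_ne τ.1 (i := ⟨k, by omega⟩) (j := ⟨k + 1, h⟩) (by simp)
        unfold pairWeight
        split_ifs <;> omega)
      have hmul := lenSeq_window_mul_simpleS τ.1 h
      simp only [Subgroup.coe_mul, Subgroup.coe_inv, hinv] at hne
      rw [if_neg hlt] at hmul
      omega
    · intro h
      by_contra hlt
      have hne := hno ⟨simpleS0D h, simpleS0D_mem_weylD h⟩ (Or.inr ⟨h, rfl⟩)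
      have hinv : (simpleS0D h)⁻¹ = simpleS0D h :=
        inv_eq_of_mul_eq_one_left (simpleS0D_mul_self h)
      have hpos := lenSeq_ne_zero τ.1 (i := ⟨0, by omega⟩) (j := ⟨1, h⟩) (by simp) (by
        have := window_ne_neg τ.1 ⟨0, by omega⟩ ⟨1, h⟩
        unfold pairWeight
        split_ifs <;> omega)
      have hmul := lenSeq_window_mul_simpleS0D τ.1 h
      simp only [Subgroup.coe_mul, Subgroup.coe_inv, hinv] at hne
      rw [if_neg hlt] at hmul
      omega

/-! ### Signed permutations as pairs of a permutation and a sign vector -/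

/-- The window with absolute values `π` and with a minus sign at the positions `i` where `ε i` is
`true`. -/
def signedWord {n : ℕ} (π : Equiv.Perm (Fin n)) (ε : Fin n → Bool) : Fin n → ℤ :=
  fun i => if ε i then -((π i).1 + 1 : ℤ) else (π i).1 + 1

namespace PMInt

/-- The identification of `[±n]` with pairs of an absolute value and a sign; `true` stands for a
minus sign. -/
noncomputable def signEquiv (n : ℕ) : Fin n × Bool ≃ PMInt n :=
  Equiv.ofBijective (fun p => if p.2 then -ofFin p.1 else ofFin p.1) <| by
    constructor
    · rintro ⟨i, b⟩ ⟨j, c⟩ h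
      cases b <;> cases c <;>
        simp_all [ofFin_injective.eq_iff, ofFin_ne_neg_ofFin, (ofFin_ne_neg_ofFin _ _).symm]
    · intro a
      obtain ⟨j, ⟨-, h⟩ | ⟨-, h⟩⟩ := exists_ofFin a
      · exact ⟨(j, false), by simp [h]⟩
      · exact ⟨(j, true), by simp [h]⟩

theorem signEquiv_apply {n : ℕ} (i : Fin n) (b : Bool) :
    signEquiv n (i, b) = if b then -ofFin i else ofFin i := rfl

theorem signEquiv_not {n : ℕ} (i : Fin n) (b : Bool) :
    signEquiv n (i, !b) = -signEquiv n (i, b) := by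
  cases b <;> simp [signEquiv_apply]

end PMInt

/-- The permutation of `Fin n × Bool` that corresponds to the window `signedWord π ε`. -/
def signedPairPerm {n : ℕ} (π : Equiv.Perm (Fin n)) (ε : Fin n → Bool) :
    Equiv.Perm (Fin n × Bool) where
  toFun p := (π p.1, xor p.2 (ε p.1))
  invFun p := (π.symm p.1, xor p.2 (ε (π.symm p.1)))
  left_inv p := by simp
  right_inv p := by simp

/-- The signed permutation with window `signedWord π ε`, for `p = (π, ε)`. -/
noncomputable def hyperoctahedralOfPair {n : ℕ} (p : Equiv.Perm (Fin n) × (Fin n → Bool)) :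
    hyperoctahedral n :=
  ⟨((PMInt.signEquiv n).symm.trans (signedPairPerm p.1 p.2)).trans (PMInt.signEquiv n), by
    intro a
    obtain ⟨⟨i, b⟩, rfl⟩ := (PMInt.signEquiv n).surjective a
    rw [← PMInt.signEquiv_not]
    simp [signedPairPerm, ← PMInt.signEquiv_not]⟩

theorem window_hyperoctahedralOfPair {n : ℕ} (p : Equiv.Perm (Fin n) × (Fin n → Bool)) :
    window (hyperoctahedralOfPair p) = signedWord p.1 p.2 := by
  funext i
  have h : PMInt.ofFin i = PMInt.signEquiv n (i, false) := rfl
  simp only [window, hyperoctahedralOfPair, Equiv.trans_apply, h, Equiv.symm_apply_apply]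
  simp only [signedPairPerm, Equiv.coe_fn_mk, Bool.false_xor, PMInt.signEquiv_apply, signedWord]
  split_ifs <;> simp

theorem signedWord_neg_iff {n : ℕ} (π : Equiv.Perm (Fin n)) (ε : Fin n → Bool) (i : Fin n) :
    signedWord π ε i < 0 ↔ ε i = true := by
  unfold signedWord
  split_ifs <;> simp_all <;> omega

theorem hyperoctahedralOfPair_bijective (n : ℕ) :
    Function.Bijective (hyperoctahedralOfPair (n := n)) := by
  constructor
  · rintro ⟨π, ε⟩ ⟨ρ, δ⟩ h
    have h : signedWord π ε = signedWord ρ δ := by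
      rw [← window_hyperoctahedralOfPair (π, ε), h, window_hyperoctahedralOfPair]
    have hε : ε = δ := by
      funext i
      rw [Bool.eq_iff_iff, ← signedWord_neg_iff π ε, ← signedWord_neg_iff ρ δ, h]
    subst hε
    refine Prod.ext (Equiv.ext fun i => Fin.ext ?_) rfl
    change (π i).1 = (ρ i).1
    have := congrFun h i
    simp only [signedWord] at this
    split_ifs at this <;> omega
  · intro σ
    choose j hj using fun i : Fin n => PMInt.exists_ofFin (σ.1 (PMInt.ofFin i))
    have hw : ∀ i, window σ i = (j i).1 + 1 ∨ window σ i = -((j i).1 + 1) := by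
      intro i
      rcases hj i with ⟨-, h⟩ | ⟨-, h⟩ <;> simp [window, h]
    have hinj : Function.Injective j := by
      intro a b hab
      by_contra hne
      have h1 := window_ne_of_ne σ hne
      have h2 := window_ne_neg σ a b
      have ha := hw a
      have hb := hw b
      rw [hab] at ha
      omega
    refine ⟨(Equiv.ofBijective j (Finite.injective_iff_bijective.mp hinj),
      fun i => decide (window σ i < 0)), window_injective ?_⟩
    rw [window_hyperoctahedralOfPair]
    funext i
    have := hw i
    simp only [signedWord, Equiv.ofBijective_apply, decide_eq_true_eq]
    split_ifs <;> omega

theorem negSeq_signedWord {n : ℕ} (π : Equiv.Perm (Fin n)) (ε : Fin n → Bool) :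
    negSeq (signedWord π ε) = #{i | ε i = true} := by
  simp only [negSeq, signedWord_neg_iff]

theorem sum_weylD_window {M : Type*} [AddCommMonoid M] {n : ℕ} (F : (Fin n → ℤ) → M) :
    ∑ σ : weylD n, F (window σ.1) =
      ∑ π : Equiv.Perm (Fin n), ∑ ε : Fin n → Bool with Even #{i | ε i = true},
        F (signedWord π ε) := by
  rw [← Finset.sum_subtype (univ.filter (· ∈ weylD n)) (by simp) (fun σ => F (window σ)),
    sum_filter, ← (Equiv.ofBijective _ (hyperoctahedralOfPair_bijective n)).sum_comp,
    Fintype.sum_prod_type]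
  refine sum_congr rfl fun π _ => ?_
  rw [sum_filter]
  refine sum_congr rfl fun ε _ => ?_
  simp only [Equiv.ofBijective_apply, mem_weylD, negCount, window_hyperoctahedralOfPair,
    negSeq_signedWord]

/-! ### Flipping one sign -/

/-- Change the sign at the position `j`. -/
def flipSign {n : ℕ} (j : Fin n) (ε : Fin n → Bool) : Fin n → Bool :=
  Function.update ε j (!ε j)

theorem flipSign_flipSign {n : ℕ} (j : Fin n) (ε : Fin n → Bool) :
    flipSign j (flipSign j ε) = ε := by
  simp [flipSign]

theorem even_card_flipSign {n : ℕ} (j : Fin n) (ε : Fin n → Bool) :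
    Even #{i | flipSign j ε i = true} ↔ ¬ Even #{i | ε i = true} := by
  have h : ∀ δ : Fin n → Bool, #{i | δ i = true} = (if δ j = true then 1 else 0) +
      ∑ i ∈ univ.erase j, if δ i = true then 1 else 0 := by
    intro δ
    rw [card_filter]
    exact (add_sum_erase _ _ (mem_univ j)).symm
  have h' : ∑ i ∈ univ.erase j, (if flipSign j ε i = true then 1 else 0) =
      ∑ i ∈ univ.erase j, if ε i = true then 1 else 0 :=
    sum_congr rfl fun i hi => by rw [flipSign, Function.update_of_ne (ne_of_mem_erase hi)]
  rw [h, h ε, h']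
  cases hε : ε j <;> simp [flipSign, hε, add_comm 1, Nat.even_add_one, -Nat.not_even_iff_odd]

/-- If flipping the sign at `j` preserves `G` and exchanges `P` with its negation, then the sign
vectors with `P` carry half of the sum of `G`. -/
theorem two_nsmul_sum_filter {M : Type*} [AddCommMonoid M] {n : ℕ} (j : Fin n)
    (P : (Fin n → Bool) → Prop) [DecidablePred P] (hP : ∀ ε, P (flipSign j ε) ↔ ¬ P ε)
    (G : (Fin n → Bool) → M) (hG : ∀ ε, G (flipSign j ε) = G ε) :
    2 • ∑ ε with P ε, G ε = ∑ ε, G ε := by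
  rw [← sum_filter_add_sum_filter_not univ P, two_nsmul]
  congr 1
  refine sum_nbij' (flipSign j) (flipSign j) ?_ ?_ ?_ ?_ ?_
  · intro ε hε
    rw [mem_filter] at hε ⊢
    exact ⟨mem_univ _, by rw [hP, not_not]; exact hε.2⟩
  · intro ε hε
    rw [mem_filter] at hε ⊢
    exact ⟨mem_univ _, (hP ε).mpr hε.2⟩
  · exact fun ε _ => flipSign_flipSign j ε
  · exact fun ε _ => flipSign_flipSign j ε
  · exact fun ε _ => (hG ε).symm

/-! ### Removing the last entry of a permutation -/

/-- The permutation of `Fin (n + 1)` with last entry `k` whose other entries are in the same relative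
order as those of `τ`. -/
noncomputable def permOfLast {n : ℕ} (k : Fin (n + 1)) (τ : Equiv.Perm (Fin n)) :
    Equiv.Perm (Fin (n + 1)) :=
  Equiv.ofBijective (Fin.snoc (α := fun _ => Fin (n + 1)) (fun i => k.succAbove (τ i)) k) <| by
    rw [← Finite.injective_iff_bijective, Fin.snoc_injective_iff]
    exact ⟨Fin.succAbove_right_injective.comp τ.injective, by
      rintro ⟨i, hi⟩
      exact Fin.succAbove_ne k _ hi⟩

@[simp] theorem permOfLast_castSucc {n : ℕ} (k : Fin (n + 1)) (τ : Equiv.Perm (Fin n))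
    (i : Fin n) : permOfLast k τ i.castSucc = k.succAbove (τ i) := by
  simp [permOfLast]

@[simp] theorem permOfLast_last {n : ℕ} (k : Fin (n + 1)) (τ : Equiv.Perm (Fin n)) :
    permOfLast k τ (Fin.last n) = k := by
  simp [permOfLast]

theorem permOfLast_bijective (n : ℕ) : Function.Bijective
    fun p : Fin (n + 1) × Equiv.Perm (Fin n) => permOfLast p.1 p.2 := by
  rw [Fintype.bijective_iff_injective_and_card]
  constructor
  · rintro ⟨k, τ⟩ ⟨l, ρ⟩ h
    have hk : k = l := by simpa using Equiv.congr_fun h (Fin.last n)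
    subst hk
    refine Prod.ext rfl (Equiv.ext fun i => ?_)
    simpa using Equiv.congr_fun h i.castSucc
  · simp [Fintype.card_perm, Nat.factorial_succ]

theorem sum_perm_succ {M : Type*} [AddCommMonoid M] {n : ℕ}
    (F : Equiv.Perm (Fin (n + 1)) → M) :
    ∑ w, F w = ∑ k : Fin (n + 1), ∑ τ : Equiv.Perm (Fin n), F (permOfLast k τ) := by
  rw [← (Equiv.ofBijective _ (permOfLast_bijective n)).sum_comp, Fintype.sum_prod_type]
  rfl

theorem sum_fin_ite_le {M : Type*} [AddCommMonoid M] {n k : ℕ} (hk : k ≤ n) (f g : ℕ → M) :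
    ∑ i : Fin n, (if k ≤ i.1 then f i.1 else g i.1) =
      ∑ i ∈ range k, g i + ∑ i ∈ range (n - k), f (k + i) := by
  obtain ⟨d, rfl⟩ := Nat.exists_eq_add_of_le hk
  rw [Fin.sum_univ_eq_sum_range (fun i => if k ≤ i then f i else g i), sum_range_add,
    Nat.add_sub_cancel_left]
  congr 1
  · exact sum_congr rfl fun i hi => if_neg (by simpa using hi)
  · exact sum_congr rfl fun i _ => if_pos (by omega)

/-! ### The generating function of the length -/

/-- The weight of a pair of entries does not depend on the sign of the left one. This makes the signs
of different positions independent, and the first sign irrelevant. -/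
theorem pairWeight_signedWord {n : ℕ} (π : Equiv.Perm (Fin n)) (ε : Fin n → Bool) {i j : Fin n}
    (hij : i ≠ j) : pairWeight (signedWord π ε i) (signedWord π ε j) =
      if π j < π i then 1 else if ε j then 2 else 0 := by
  have h : (π i).1 ≠ (π j).1 := fun h => hij (π.injective (Fin.ext h))
  simp only [pairWeight, signedWord, Fin.lt_def]
  split_ifs <;> omega

theorem lenSeq_signedWord {n : ℕ} (π : Equiv.Perm (Fin n)) (ε : Fin n → Bool) :
    lenSeq (signedWord π ε) = ∑ i : Fin n, ∑ j : Fin n,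
      if i < j then (if π j < π i then 1 else if ε j then 2 else 0) else 0 := by
  refine sum_congr rfl fun i _ => sum_congr rfl fun j _ => ?_
  by_cases h : i < j
  · rw [if_pos h, if_pos h, pairWeight_signedWord π ε h.ne]
  · rw [if_neg h, if_neg h]

theorem lenSeq_signedWord_flipSign {n : ℕ} (π : Equiv.Perm (Fin (n + 1)))
    (ε : Fin (n + 1) → Bool) :
    lenSeq (signedWord π (flipSign 0 ε)) = lenSeq (signedWord π ε) := by
  rw [lenSeq_signedWord, lenSeq_signedWord]
  refine sum_congr rfl fun i _ => sum_congr rfl fun j _ => ?_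
  by_cases hij : i < j
  · rw [flipSign, Function.update_of_ne (Fin.ne_zero_of_lt hij)]
  · rw [if_neg hij, if_neg hij]

theorem lenSeq_signedWord_permOfLast {n : ℕ} (k : Fin (n + 1)) (τ : Equiv.Perm (Fin n))
    (ε : Fin n → Bool) (b : Bool) :
    lenSeq (signedWord (permOfLast k τ) (Fin.snoc (α := fun _ => Bool) ε b)) =
      lenSeq (signedWord τ ε) + (n - k.1 + if b then 2 * k.1 else 0) := by
  have hlast : ∑ i : Fin n, (if k < k.succAbove (τ i) then 1 else if b then 2 else 0) =
      n - k.1 + if b then 2 * k.1 else 0 := by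
    rw [Equiv.sum_comp τ (fun i => if k < k.succAbove i then 1 else if b then 2 else 0)]
    simp only [Fin.lt_succAbove_iff_le_castSucc, Fin.le_def, Fin.val_castSucc]
    rw [sum_fin_ite_le (Nat.lt_succ_iff.mp k.2) (fun _ => 1) (fun _ => if b then 2 else 0)]
    cases b
    · simp
    · simp only [if_true, sum_const, card_range, smul_eq_mul]
      ring
  rw [lenSeq_signedWord, lenSeq_signedWord, Fin.sum_univ_castSucc]
  simp only [Fin.sum_univ_castSucc, permOfLast_castSucc, permOfLast_last, Fin.snoc_castSucc,
    Fin.snoc_last, Fin.castSucc_lt_last, if_true, Fin.castSucc_lt_castSucc_iff,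
    Fin.succAbove_lt_succAbove_iff, sum_add_distrib, hlast]
  simp [not_lt_of_ge (Fin.le_last _)]

/-- A last entry of absolute value `k + 1` contributes `n - k` to the length if it is positive and
`n + k` if it is negative, which gives the factor `∑ k, (q ^ (n - k) + q ^ (n + k))`. -/
theorem sum_pow_lenSeq {R : Type*} [CommSemiring R] (q : R) (n : ℕ) :
    ∑ π : Equiv.Perm (Fin n), ∑ ε : Fin n → Bool, q ^ lenSeq (signedWord π ε) =
      ∏ m ∈ range n, ((∑ i ∈ range (m + 1), q ^ i) * (1 + q ^ m)) := by
  induction n with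
  | zero => simp [lenSeq]
  | succ n ih =>
    have hsnoc : ∀ G : (Fin (n + 1) → Bool) → R, ∑ ε, G ε =
        ∑ ε : Fin n → Bool, ∑ b, G (Fin.snoc (α := fun _ => Bool) ε b) := by
      intro G
      rw [← (Fin.snocEquiv fun _ => Bool).sum_comp, Fintype.sum_prod_type_right]
      rfl
    have hlast : ∑ k : Fin (n + 1), ∑ b : Bool, q ^ (n - k.1 + if b then 2 * k.1 else 0) =
        (∑ i ∈ range (n + 1), q ^ i) * (1 + q ^ n) := by
      simp only [Fintype.sum_bool, if_true, Bool.false_eq_true, if_false, add_zero]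
      rw [sum_add_distrib, mul_add, mul_one, add_comm]
      congr 1
      · rw [Fin.sum_univ_eq_sum_range (fun k => q ^ (n - k)), ← sum_range_reflect]
        refine sum_congr rfl fun k hk => ?_
        congr 1
        have := mem_range.mp hk
        omega
      · rw [Fin.sum_univ_eq_sum_range (fun k => q ^ (n - k + 2 * k)), sum_mul]
        refine sum_congr rfl fun k hk => ?_
        rw [← pow_add]
        congr 1
        have := mem_range.mp hk
        omega
    rw [sum_perm_succ, prod_range_succ, ← ih, ← hlast]
    simp only [hsnoc, lenSeq_signedWord_permOfLast, pow_add _ (lenSeq _)]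
    simp only [← mul_sum, ← sum_mul]

/-! ### The major index with a prescribed last entry -/

/-- The major index depends only on the relative order of the entries. -/
theorem majSeq_congr {n : ℕ} {a b : Fin n → ℤ} (h : ∀ i j, a i < a j ↔ b i < b j) :
    majSeq a = majSeq b := by
  simp only [majSeq, gt_iff_lt, h]

theorem majSeq_succ {n : ℕ} (a : Fin (n + 2) → ℤ) :
    majSeq a = majSeq (fun i : Fin (n + 1) => a i.castSucc) +
      if a (Fin.last (n + 1)) < a (Fin.last n).castSucc then n + 1 else 0 := by
  simp only [majSeq]
  rw [Fin.sum_univ_castSucc, Fin.sum_univ_castSucc,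
    Fin.sum_univ_castSucc (n := n) (fun i => dite (i.1 + 1 < n + 1) _ _)]
  simp [Fin.last, Fin.castSucc, Fin.castAdd, Fin.castLE]

/-- A permutation as a sequence of integers. -/
def permWord {n : ℕ} (w : Equiv.Perm (Fin n)) : Fin n → ℤ := fun i => (w i).1

theorem majSeq_permWord_permOfLast {n : ℕ} (k : Fin (n + 2)) (τ : Equiv.Perm (Fin (n + 1))) :
    majSeq (permWord (permOfLast k τ)) =
      majSeq (permWord τ) + if k.1 ≤ (τ (Fin.last n)).1 then n + 1 else 0 := by
  have hlt : ∀ x : Fin (n + 1), (k.1 : ℤ) < (k.succAbove x).1 ↔ k.1 ≤ x.1 := by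
    intro x
    rw [Nat.cast_lt, ← Fin.lt_def, Fin.lt_succAbove_iff_le_castSucc, Fin.le_def, Fin.val_castSucc]
  rw [majSeq_succ]
  congr 1
  · refine majSeq_congr fun i j => ?_
    simp [permWord, Fin.val_fin_lt, Fin.succAbove_lt_succAbove_iff]
  · simp only [permWord, permOfLast_last, permOfLast_castSucc, hlt]

/-- The distribution of the major index over the permutations with last entry `k`. In the induction
the entry `j` before the last one varies, and position `n + 1` is a descent exactly if `k ≤ j`. -/
theorem sum_pow_majSeq_permOfLast {R : Type*} [CommSemiring R] (p : R) (n : ℕ) (k : Fin (n + 1)) :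
    ∑ τ : Equiv.Perm (Fin n), p ^ majSeq (permWord (permOfLast k τ)) =
      p ^ (n - k.1) * ∏ m ∈ range n, ∑ i ∈ range (m + 1), p ^ i := by
  induction n with
  | zero =>
    simp [majSeq]
  | succ n ih =>
    have hk : k.1 ≤ n + 1 := Nat.lt_succ_iff.mp k.2
    have hsum : ∑ j : Fin (n + 1), p ^ (n - j.1) * p ^ (if k.1 ≤ j.1 then n + 1 else 0) =
        p ^ (n + 1 - k.1) * ∑ i ∈ range (n + 1), p ^ i := by
      have hite : ∀ j : ℕ, p ^ (n - j) * p ^ (if k.1 ≤ j then n + 1 else 0) =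
          if k.1 ≤ j then p ^ (n - j + (n + 1)) else p ^ (n - j) := by
        intro j
        split_ifs <;> simp [pow_add]
      simp only [hite]
      rw [sum_fin_ite_le hk (fun j => p ^ (n - j + (n + 1))) (fun j => p ^ (n - j))]
      obtain ⟨d, hd⟩ := Nat.exists_eq_add_of_le hk
      have hr : ∑ i ∈ range (n + 1), p ^ i =
          ∑ i ∈ range k.1, p ^ i + ∑ i ∈ range d, p ^ (k.1 + i) := by
        rw [← sum_range_add (fun i => p ^ i), ← hd]
      rw [show n + 1 - k.1 = d by omega, hr, mul_add, mul_sum, mul_sum,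
        ← sum_range_reflect _ k.1, ← sum_range_reflect _ d]
      congr 1 <;> refine sum_congr rfl fun i hi => ?_ <;>
        have := mem_range.mp hi <;> rw [← pow_add] <;> congr 1 <;> omega
    rw [sum_perm_succ, prod_range_succ, mul_comm (∏ m ∈ range n, _), ← mul_assoc, ← hsum, sum_mul]
    refine sum_congr rfl fun j _ => ?_
    simp only [majSeq_permWord_permOfLast, permOfLast_last, pow_add, ← sum_mul]
    rw [ih]
    ring

theorem sum_pow_majSeq_le_last {R : Type*} [CommSemiring R] (p : R) {n m : ℕ} (hm : m ≤ n + 1) :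
    ∑ w : Equiv.Perm (Fin (n + 1)) with m ≤ (w (Fin.last n)).1, p ^ majSeq (permWord w) =
      (∑ i ∈ range (n + 1 - m), p ^ i) * ∏ j ∈ range n, ∑ i ∈ range (j + 1), p ^ i := by
  rw [sum_filter, sum_perm_succ]
  have hsum : ∑ k : Fin (n + 1), (if m ≤ k.1 then p ^ (n - k.1) else 0) =
      ∑ i ∈ range (n + 1 - m), p ^ i := by
    rw [sum_fin_ite_le hm (fun k => p ^ (n - k)) (fun _ => 0), sum_const_zero, zero_add,
      ← sum_range_reflect]
    refine sum_congr rfl fun i hi => ?_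
    have := mem_range.mp hi
    congr 1
    omega
  rw [← hsum, sum_mul]
  refine sum_congr rfl fun k _ => ?_
  simp only [permOfLast_last]
  split_ifs
  · exact sum_pow_majSeq_permOfLast p n k
  · simp

/-! ### The generating function of the flag major index -/

theorem signedWord_injective {n : ℕ} (π : Equiv.Perm (Fin n)) (ε : Fin n → Bool) :
    Function.Injective (signedWord π ε) := by
  intro i j h
  refine π.injective (Fin.ext ?_)
  simp only [signedWord] at h
  split_ifs at h <;> omega

theorem negSeq_comp {n : ℕ} (a : Fin n → ℤ) (π : Equiv.Perm (Fin n)) :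
    negSeq (a ∘ π) = negSeq a := by
  simp only [negSeq, card_filter, Function.comp_apply]
  exact Equiv.sum_comp π (fun i => if a i < 0 then 1 else 0)

/-- For a fixed set of distinct values `f`, only the relative order of the arrangement matters for
`majSeq`, and the last entry is nonnegative exactly if at least `negSeq f` values are smaller. -/
theorem sum_pow_fmajSeq_comp {R : Type*} [CommSemiring R] (q : R) {n : ℕ} (f : Fin (n + 1) → ℤ)
    (hf : Function.Injective f) :
    ∑ π : Equiv.Perm (Fin (n + 1)) with ¬ f (π (Fin.last n)) < 0, q ^ fmajSeq (f ∘ π) =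
      q ^ negSeq f * ((∑ i ∈ range (n + 1 - negSeq f), (q ^ 2) ^ i) *
        ∏ j ∈ range n, ∑ i ∈ range (j + 1), (q ^ 2) ^ i) := by
  -- relative to the increasing arrangement `f ∘ s`, arrangements are permutations `w`
  set s := Tuple.sort f
  have hmono : StrictMono (f ∘ s) :=
    (Tuple.monotone_sort f).strictMono_of_injective (hf.comp s.injective)
  have hneg : ∀ i, f (s i) < 0 ↔ i.1 < negSeq f := by
    intro i
    rw [← negSeq_comp f s]
    exact (Tuple.lt_card_lt_iff_apply_lt_of_monotone hmono.monotone).symm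
  have hle : negSeq f ≤ n + 1 := (card_filter_le _ _).trans (by simp)
  rw [← sum_pow_majSeq_le_last (q ^ 2) hle, mul_sum, sum_filter, sum_filter,
    ← Equiv.sum_comp (Equiv.mulLeft s)]
  refine sum_congr rfl fun w _ => ?_
  simp only [Equiv.coe_mulLeft, Equiv.Perm.mul_apply, hneg, not_lt]
  refine if_congr Iff.rfl ?_ rfl
  have hmaj : majSeq (f ∘ (s * w : Equiv.Perm (Fin (n + 1)))) = majSeq (permWord w) := by
    refine majSeq_congr fun i j => ?_
    simp only [permWord, Nat.cast_lt, Fin.val_fin_lt]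
    exact hmono.lt_iff_lt
  rw [fmajSeq, hmaj, negSeq_comp, pow_add, pow_mul, mul_comm]

/-- The sum over the sign vectors, with the denominator of the geometric series cleared: both
resulting sums are binomial expansions. -/
theorem one_sub_sq_mul_sum_signs {R : Type*} [CommRing R] (q : R) (N : ℕ) :
    (1 - q ^ 2) * ∑ δ : Fin N → Bool, q ^ #{i | δ i = true} *
        ∑ i ∈ range (N - #{i | δ i = true}), (q ^ 2) ^ i =
      (1 + q) ^ N * (1 - q ^ N) := by
  have hgen : ∀ x : R, ∑ δ : Fin N → Bool, q ^ #{i | δ i = true} * x ^ (N - #{i | δ i = true}) =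
      (q + x) ^ N := by
    intro x
    have h := Fintype.prod_sum (fun (_ : Fin N) (b : Bool) => if b then q else x)
    simp only [Fintype.sum_bool, if_true, Bool.false_eq_true, if_false, prod_const, card_univ,
      Fintype.card_fin] at h
    rw [h]
    refine sum_congr rfl fun δ _ => ?_
    have hc := card_filter_add_card_filter_not (s := univ) (fun i : Fin N => δ i = true)
    rw [card_univ, Fintype.card_fin] at hc
    rw [prod_ite, prod_const, prod_const]
    congr 2
    omega
  have h1 := hgen 1
  have h2 := hgen (q ^ 2)
  simp only [one_pow, mul_one] at h1
  rw [mul_sum]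
  simp only [mul_left_comm (1 - q ^ 2), mul_neg_geom_sum, mul_sub, mul_one]
  rw [sum_sub_distrib, h1, h2, show q + q ^ 2 = q * (1 + q) by ring, mul_pow]
  ring

theorem sum_range_sq_pow_mul_one_add {R : Type*} [CommSemiring R] (q : R) (m : ℕ) :
    (∑ i ∈ range m, (q ^ 2) ^ i) * (1 + q) = (∑ i ∈ range m, q ^ i) * (1 + q ^ m) := by
  have h : (∑ i ∈ range m, (q ^ 2) ^ i) * (1 + q) = ∑ i ∈ range (m + m), q ^ i := by
    induction m with
    | zero => simp
    | succ m ih =>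
      rw [sum_range_succ, add_mul, ih, show m + 1 + (m + 1) = m + m + 1 + 1 by ring,
        sum_range_succ, sum_range_succ]
      ring
  rw [h, sum_range_add, mul_add, mul_one, mul_comm _ (q ^ m), mul_sum]
  simp only [pow_add]

theorem prod_sum_sq_pow_mul {R : Type*} [CommSemiring R] (q : R) (n : ℕ) :
    (∏ j ∈ range n, ∑ i ∈ range (j + 1), (q ^ 2) ^ i) * (1 + q) ^ n * ∑ i ∈ range (n + 1), q ^ i =
      ∏ j ∈ range n, ((∑ i ∈ range (j + 2), q ^ i) * (1 + q ^ (j + 1))) := by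
  induction n with
  | zero => simp
  | succ n ih =>
    have h := sum_range_sq_pow_mul_one_add q (n + 1)
    rw [prod_range_succ _ n, prod_range_succ _ n, ← ih, pow_succ (1 + q), mul_mul_mul_comm, h]
    ac_rfl

theorem sum_pow_fmajD (n : ℕ) :
    ∑ σ : weylD (n + 1), (X : ℤ[X]) ^ fmajD σ =
      ∏ m ∈ range n, ((∑ i ∈ range (m + 2), X ^ i) * (1 + X ^ (m + 1))) := by
  set F : (Fin (n + 1) → ℤ) → ℤ[X] := fun a =>
    X ^ fmajSeq fun i : Fin (n + 1) => if i.1 + 1 = n + 1 then |a i| else a i with hF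
  -- the sign of the last entry does not matter, so it may be taken positive
  have hlast : ∀ π : Equiv.Perm (Fin (n + 1)),
      ∑ ε : Fin (n + 1) → Bool with Even #{i | ε i = true}, F (signedWord π ε) =
        ∑ ε : Fin (n + 1) → Bool with ε (Fin.last n) = false,
          X ^ fmajSeq (signedWord π ε) := by
    intro π
    have hflip : ∀ ε, F (signedWord π (flipSign (Fin.last n) ε)) = F (signedWord π ε) := by
      intro ε
      simp only [hF]
      congr 2
      funext i
      by_cases hi : i = Fin.last n
      · subst hi
        simp only [Fin.val_last, if_true, signedWord, flipSign, Function.update_self]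
        cases ε (Fin.last n) <;> simp only [Bool.not_true, Bool.not_false, if_true,
          Bool.false_eq_true, if_false, abs_neg]
      · simp only [signedWord, flipSign, Function.update_of_ne hi]
    have h1 := two_nsmul_sum_filter (Fin.last n) (fun ε => Even #{i | ε i = true})
      (even_card_flipSign _) (fun ε => F (signedWord π ε)) hflip
    have h2 := two_nsmul_sum_filter (Fin.last n) (fun ε => ε (Fin.last n) = false)
      (fun ε => by simp [flipSign]) (fun ε => F (signedWord π ε)) hflip
    refine (nsmul_right_injective two_ne_zero (h1.trans h2.symm)).trans ?_
    refine sum_congr rfl fun ε hε => ?_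
    simp only [hF]
    congr 2
    funext i
    split_ifs with hi
    · have hi' : i = Fin.last n := Fin.ext (by simpa using hi)
      have hε' : ¬ signedWord π ε i < 0 := by
        rw [signedWord_neg_iff, hi', (mem_filter.mp hε).2]
        simp
      exact abs_of_nonneg (not_lt.mp hε')
    · rfl
  -- the signs are attached to the values instead of the positions
  have hvalues : ∑ π : Equiv.Perm (Fin (n + 1)),
      ∑ ε : Fin (n + 1) → Bool with ε (Fin.last n) = false,
        (X : ℤ[X]) ^ fmajSeq (signedWord π ε) =
      ∑ δ : Fin (n + 1) → Bool, ∑ π : Equiv.Perm (Fin (n + 1)) with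
        ¬ signedWord 1 δ (π (Fin.last n)) < 0, X ^ fmajSeq (signedWord 1 δ ∘ π) := by
    simp only [sum_filter]
    refine Eq.trans (sum_congr rfl fun π _ => ?_) sum_comm
    refine (Equiv.sum_comp (π.symm.arrowCongr (Equiv.refl Bool)) _).symm.trans ?_
    refine sum_congr rfl fun δ _ => if_congr ?_ rfl rfl
    rw [signedWord_neg_iff, Bool.not_eq_true]
    rfl
  have hone : (1 - X ^ 2 : ℤ[X]) ≠ 0 := by
    intro h
    have := congrArg (eval 0) h
    simp at this
  have hsigns := one_sub_sq_mul_sum_signs (X : ℤ[X]) (n + 1)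
  have hgeom := mul_neg_geom_sum (X : ℤ[X]) (n + 1)
  change ∑ σ : weylD (n + 1), F (window σ.1) = _
  rw [sum_weylD_window, sum_congr rfl fun π _ => hlast π, hvalues]
  simp only [sum_pow_fmajSeq_comp _ _ (signedWord_injective 1 _), negSeq_signedWord]
  simp only [← mul_assoc, ← sum_mul]
  rw [← prod_sum_sq_pow_mul]
  apply mul_left_cancel₀ hone
  rw [← mul_assoc, hsigns, ← hgeom]
  ring

theorem mainTheorem6 (n : ℕ) (hn : 1 ≤ n) :
    ∑ σ : weylD n, (X : ℤ[X]) ^ fmajD σ = ∑ σ : weylD n, (X : ℤ[X]) ^ lengthD σ := by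
  obtain ⟨n, rfl⟩ : ∃ m, n = m + 1 := ⟨n - 1, by omega⟩
  rw [sum_pow_fmajD]
  simp only [lengthD_eq_lenSeq]
  rw [sum_weylD_window (fun a => (X : ℤ[X]) ^ lenSeq a)]
  apply nsmul_right_injective two_ne_zero
  change 2 • _ = 2 • _
  rw [smul_sum, sum_congr rfl fun π _ => two_nsmul_sum_filter 0
    (fun ε : Fin (n + 1) → Bool => Even #{i | ε i = true}) (even_card_flipSign 0)
    (fun ε => (X : ℤ[X]) ^ lenSeq (signedWord π ε))
    (fun ε => by rw [lenSeq_signedWord_flipSign]), sum_pow_lenSeq, prod_range_succ']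
  simp only [prod_mul_distrib, nsmul_eq_mul]
  simp only [zero_add, range_one, sum_singleton, pow_zero, Nat.cast_ofNat, add_assoc,
    one_add_one_eq_two]
  ring
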